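/- For an integer $n$ let $K_n$ be the $n$-twist knot, normalized so that $K_1$ is the figure-eight knot, with Alexander polynomial $-nt^2+(2n+1)t-n$ and right-handed trefoil $K_{-1}$. Its knot group has the presentation $$\pi_1(E_{K_n})=\langle \alpha,\beta \mid \alpha\,\omega^n=\omega^n\beta\rangle,\qquad \omega=\beta\alpha^{-1}\beta^{-1}\alpha,$$ with meridian $m=\alpha$ and corresponding preferred longitude $\ell=\omega^n(\omega^*)^n$, where $\omega^*=\alpha\beta^{-1}\alpha^{-1}\beta$. Suppose that $n\neq 0,-1$, i.e. that $K_n$ is hyperbolic. Let $M$ be the closed 3-manifold obtained by $4$-surgery along $K_n$, so that $\pi_1(M)=\pi_1(E_{K_n})/\langle\langle m^4\ell\rangle\rangle$, where $\langle\langle\cdot\rangle\rangle$ denotes the normal closure. A homomorphism $\rho$ from a group $G$ to $\mathrm{SL}(2,\mathbb C)$ is called irreducible if the only subspaces of $\mathbb C^2$ invariant under $\rho(G)$ are $0$ and $\mathbb C^2$, and metabelian if $\rho([G,G])$ is abelian. **Proposition 3.1.** Every irreducible representation $\bar\rho:\pi_1(M)\to \mathrm{SL}(2,\mathbb C)$ is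 induced by an irreducible metabelian representation of $\pi_1(E_{K_n})$; that is, the composition of $\bar\rho$ with the quotient map $\pi_1(E_{K_n})\to\pi_1(M)$ is irreducible and metabelian. Moreover, if the set $R^{\mathrm{irr}}(M)$ of irreducible $\mathrm{SL}(2,\mathbb C)$-representations of $\pi_1(M)$ is regarded as a set of representations of $\pi_1(E_{K_n})$ by pull-back along the quotient map, then $$R^{\mathrm{irr}}(M)=\{\rho:\pi_1(E_{K_n})\to \mathrm{SL}(2,\mathbb C)\mid \rho \text{ is irreducible and metabelian}\}.$$ -/

import Mathlib

open scoped MatrixGroups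

namespace TwistKnot

/-- The generator `α` of the free group on two letters. -/
def genα : FreeGroup (Fin 2) := FreeGroup.of 0

/-- The generator `β` of the free group on two letters. -/
def genβ : FreeGroup (Fin 2) := FreeGroup.of 1

/-- The word `ω = β α⁻¹ β⁻¹ α`. -/
def wordω : FreeGroup (Fin 2) := genβ * genα⁻¹ * genβ⁻¹ * genα

/-- The word `ω* = α β⁻¹ α⁻¹ β`, that is, `ω` read backwards. -/
def wordωrev : FreeGroup (Fin 2) := genα * genβ⁻¹ * genα⁻¹ * genβ

/-- The relator `(α ωⁿ) (ωⁿ β)⁻¹` of the group of the `n`-twist knot. -/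
def relator (n : ℤ) : FreeGroup (Fin 2) := (genα * wordω ^ n) * (wordω ^ n * genβ)⁻¹

/-- The knot group `π₁(E_{K_n}) = ⟨α, β | α ωⁿ = ωⁿ β⟩` of the `n`-twist knot `K_n`, where
`ω = β α⁻¹ β⁻¹ α` and `α`, `β` are meridians. The normalization is that `K_1` is the figure-eight
knot and that `K_n` has Alexander polynomial `-n t² + (2n+1) t - n`; for instance `K_{-1}` is the
right-handed trefoil, `K_2` is `6_1` and `K_{-2}` is `5_2`. -/
abbrev KnotGroup (n : ℤ) : Type := PresentedGroup ({relator n} : Set (FreeGroup (Fin 2)))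

/-- The meridian `m = α` of the `n`-twist knot. -/
def meridian (n : ℤ) : KnotGroup n := PresentedGroup.mk {relator n} genα

/-- The preferred longitude `ℓ = ωⁿ (ω*)ⁿ` of the `n`-twist knot that belongs to the meridian
`m = α`. -/
def longitude (n : ℤ) : KnotGroup n := PresentedGroup.mk {relator n} (wordω ^ n * wordωrev ^ n)

/-- The meridian and the longitude commute: they are peripheral elements for the same torus. -/
theorem meridian_longitude_comm (n : ℤ) : Commute (meridian n) (longitude n) := by
  have hrel : PresentedGroup.mk {relator n} (genα * wordω ^ n)
      = PresentedGroup.mk {relator n} (wordω ^ n * genβ) := by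
    have h := PresentedGroup.one_of_mem (rels := {relator n}) (x := relator n) rfl
    rwa [relator, map_mul, map_inv, mul_inv_eq_one] at h
  simp only [map_mul, map_zpow] at hrel
  set a := PresentedGroup.mk {relator n} genα with ha
  set b := PresentedGroup.mk {relator n} genβ with hb
  set w := PresentedGroup.mk {relator n} wordω with hw
  have hw' : w = b * a⁻¹ * b⁻¹ * a := by simp [hw, ha, hb, wordω]
  have hv : PresentedGroup.mk {relator n} wordωrev
      = (a * b⁻¹) * w⁻¹ * (a * b⁻¹)⁻¹ := by
    simp only [wordωrev, map_mul, map_inv, ← ha, ← hb, hw']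
    group
  have key : b * PresentedGroup.mk {relator n} wordωrev ^ n
      = PresentedGroup.mk {relator n} wordωrev ^ n * a := by
    have e1 : a * w⁻¹ * w ^ n = w ^ n * (b * w⁻¹) := by
      calc a * w⁻¹ * w ^ n = a * w ^ n * w⁻¹ := by group
        _ = w ^ n * (b * w⁻¹) := by rw [hrel, mul_assoc]
    have e2 : (w ^ n)⁻¹ * (a * w⁻¹) = b * w⁻¹ * (w ^ n)⁻¹ := by
      rw [inv_mul_eq_iff_eq_mul, ← mul_assoc, ← e1]; group
    have e3 : (a * b⁻¹)⁻¹ * a = a * w⁻¹ * (a * b⁻¹)⁻¹ := by rw [hw']; group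
    have e4 : b * (a * b⁻¹) = a * b⁻¹ * (b * w⁻¹) := by rw [hw']; group
    rw [hv, conj_zpow, inv_zpow]
    calc b * (a * b⁻¹ * (w ^ n)⁻¹ * (a * b⁻¹)⁻¹)
        = b * (a * b⁻¹) * (w ^ n)⁻¹ * (a * b⁻¹)⁻¹ := by simp only [mul_assoc]
      _ = a * b⁻¹ * (b * w⁻¹ * (w ^ n)⁻¹) * (a * b⁻¹)⁻¹ := by rw [e4]; simp only [mul_assoc]
      _ = a * b⁻¹ * (w ^ n)⁻¹ * (a * w⁻¹ * (a * b⁻¹)⁻¹) := by rw [← e2]; simp only [mul_assoc]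
      _ = a * b⁻¹ * (w ^ n)⁻¹ * (a * b⁻¹)⁻¹ * a := by rw [← e3]; simp only [mul_assoc]
  simp only [Commute, SemiconjBy, meridian, longitude, map_mul, map_zpow, ← ha, ← hw]
  rw [← mul_assoc, hrel, mul_assoc, key, mul_assoc]

/-- The longitude is null-homologous. -/
theorem longitude_mem_commutator (n : ℤ) : longitude n ∈ commutator (KnotGroup n) := by
  have aux : ∀ {A : Type} [CommGroup A] (x y : A), y * x⁻¹ * y⁻¹ * x = 1 := by
    intro A _ x y
    rw [mul_right_comm y]
    simp
  rw [← Abelianization.ker_of, MonoidHom.mem_ker]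
  simp only [longitude, wordω, wordωrev, map_mul, map_zpow, map_inv, aux, one_zpow, mul_one]

/-- The element `m⁴ℓ` that is killed by `4`-surgery along `K_n`. -/
def surgeryRelator (n : ℤ) : KnotGroup n := meridian n ^ 4 * longitude n

/-- The fundamental group `π₁(M) = π₁(E_{K_n}) / ⟨⟨m⁴ℓ⟩⟩` of the closed manifold `M` that is
obtained by `4`-surgery along `K_n`. -/
abbrev SurgeryGroup (n : ℤ) : Type :=
  KnotGroup n ⧸ Subgroup.normalClosure ({surgeryRelator n} : Set (KnotGroup n))

/-- The quotient map `π₁(E_{K_n}) → π₁(M)`. -/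
def quotientMap (n : ℤ) : KnotGroup n →* SurgeryGroup n := QuotientGroup.mk' _

/-- An `SL(2,ℂ)`-representation is irreducible if the only subspaces of `ℂ²` that are invariant
under its image are `0` and `ℂ²`. -/
def IsIrreducible {G : Type*} [Group G] (ρ : G →* SL(2, ℂ)) : Prop :=
  ∀ W : Submodule ℂ (Fin 2 → ℂ),
    (∀ g : G, ∀ v ∈ W, (ρ g : Matrix (Fin 2) (Fin 2) ℂ).mulVec v ∈ W) → W = ⊥ ∨ W = ⊤

/-- A representation is metabelian if it sends the commutator subgroup to an abelian subgroup. -/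
def IsMetabelian {G : Type*} [Group G] (ρ : G →* SL(2, ℂ)) : Prop :=
  ∀ x ∈ commutator G, ∀ y ∈ commutator G, ρ x * ρ y = ρ y * ρ x

end TwistKnot

namespace TwistKnot

open Matrix

/-! ### Two-by-two matrices -/

theorem SL2.coe_inv_eq (A : SL(2, ℂ)) :
    ((A⁻¹ : SL(2, ℂ)) : Matrix (Fin 2) (Fin 2) ℂ) = trace A.1 • 1 - A.1 := by
  rw [Matrix.SpecialLinearGroup.coe_inv, adjugate_fin_two]
  ext i j
  fin_cases i <;> fin_cases j <;> simp [trace_fin_two]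

theorem SL2.det_eq (A : SL(2, ℂ)) : A.1 0 0 * A.1 1 1 - A.1 0 1 * A.1 1 0 = 1 := by
  rw [← det_fin_two]; exact A.2

theorem SL2.mul_self (A : SL(2, ℂ)) : A.1 * A.1 = trace A.1 • A.1 - 1 := by
  have h : A.1 * ((A⁻¹ : SL(2, ℂ)) : Matrix (Fin 2) (Fin 2) ℂ) = 1 := by
    rw [← Matrix.SpecialLinearGroup.coe_mul, mul_inv_cancel, Matrix.SpecialLinearGroup.coe_one]
  rw [SL2.coe_inv_eq, mul_sub, mul_smul_comm, mul_one] at h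
  rw [← h]; abel

theorem SL2.trace_inv (A : SL(2, ℂ)) :
    trace ((A⁻¹ : SL(2, ℂ)) : Matrix (Fin 2) (Fin 2) ℂ) = trace A.1 := by
  rw [SL2.coe_inv_eq]; simp; ring

theorem SL2.trace_conj (A P : SL(2, ℂ)) : trace (P * A * P⁻¹ : SL(2, ℂ)).1 = trace A.1 := by
  change trace (P.1 * A.1 * (P⁻¹).1) = _
  rw [trace_mul_comm, ← mul_assoc, ← Matrix.SpecialLinearGroup.coe_mul, inv_mul_cancel]
  simp

/-- Fricke's formula for the trace of a commutator. -/
theorem SL2.trace_commutator (A B : SL(2, ℂ)) :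
    trace (B * A⁻¹ * B⁻¹ * A : SL(2, ℂ)).1 =
      trace A.1 ^ 2 + trace B.1 ^ 2 + trace (A.1 * B.1) ^ 2
        - trace A.1 * trace B.1 * trace (A.1 * B.1) - 2 := by
  have hA := SL2.det_eq A
  have hB := SL2.det_eq B
  simp only [Matrix.SpecialLinearGroup.coe_mul, Matrix.SpecialLinearGroup.coe_inv, adjugate_fin_two,
    trace_fin_two, mul_apply, Fin.sum_univ_two, of_apply, cons_val', cons_val_zero,
    cons_val_one, cons_val_fin_one]
  linear_combination (A.1 0 0 + A.1 1 1) ^ 2 * hB + (B.1 0 0 + B.1 1 1) ^ 2 * hA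
    - 2 * (B.1 0 0 * B.1 1 1 - B.1 0 1 * B.1 1 0) * hA - 2 * hB

/-- The polarized Cayley-Hamilton theorem, for a trace-free first matrix. -/
theorem mul_add_mul_of_trace_eq_zero {N : Matrix (Fin 2) (Fin 2) ℂ} (hN : trace N = 0)
    (A : Matrix (Fin 2) (Fin 2) ℂ) :
    A * N = N * (trace A • 1 - A) + trace (N * A) • 1 := by
  rw [trace_fin_two] at hN
  have h : N 1 1 = - N 0 0 := by linear_combination hN
  ext i j
  fin_cases i <;> fin_cases j <;>
    simp [trace_fin_two, mul_apply, Fin.sum_univ_two, h] <;> ring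

theorem mul_self_of_trace_eq_zero {N : Matrix (Fin 2) (Fin 2) ℂ} (hN : trace N = 0) :
    N * N = (-det N) • 1 := by
  rw [trace_fin_two] at hN
  have h : N 1 1 = - N 0 0 := by linear_combination hN
  ext i j
  fin_cases i <;> fin_cases j <;> simp [det_fin_two, mul_apply, Fin.sum_univ_two, h] <;> ring

/-! ### Generation of the knot group -/

/-- The second meridian `β`. -/
def meridian' (n : ℤ) : KnotGroup n := PresentedGroup.mk {relator n} genβ

variable {n : ℤ}

theorem mem_of_meridians_mem {H : Subgroup (KnotGroup n)} (ha : meridian n ∈ H)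
    (hb : meridian' n ∈ H) (g : KnotGroup n) : g ∈ H := by
  have h : Subgroup.closure (Set.range (PresentedGroup.of (rels := {relator n}))) ≤ H := by
    rw [Subgroup.closure_le]
    rintro _ ⟨i, rfl⟩
    fin_cases i
    · exact ha
    · exact hb
  rw [PresentedGroup.closure_range_of] at h
  exact h (Subgroup.mem_top g)

/-- The image of `ω` in the knot group. -/
def omega (n : ℤ) : KnotGroup n := meridian' n * (meridian n)⁻¹ * (meridian' n)⁻¹ * meridian n

theorem mk_wordω (n : ℤ) : PresentedGroup.mk {relator n} wordω = omega n := by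
  simp [wordω, omega, meridian, meridian']

theorem relation (n : ℤ) : meridian n * omega n ^ n = omega n ^ n * meridian' n := by
  have h := PresentedGroup.one_of_mem (rels := {relator n}) (x := relator n) rfl
  rw [relator, map_mul, map_inv, mul_inv_eq_one] at h
  simp only [map_mul, map_zpow] at h
  exact h

theorem meridian'_eq (n : ℤ) : meridian' n = (omega n ^ n)⁻¹ * meridian n * omega n ^ n := by
  rw [mul_assoc, relation]; group

theorem longitude_eq_mul (n : ℤ) : longitude n = omega n ^ n *
    (meridian n * (meridian' n)⁻¹ * (meridian n)⁻¹ * meridian' n) ^ n := by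
  simp [longitude, mk_wordω, wordωrev, meridian, meridian']

theorem longitude_eq (n : ℤ) : longitude n = omega n ^ n * meridian n * (omega n ^ n)⁻¹ *
    (meridian n)⁻¹ * meridian' n * (meridian n)⁻¹ := by
  have h : meridian n * (meridian' n)⁻¹ * (meridian n)⁻¹ * meridian' n =
      (meridian n * (meridian' n)⁻¹) * (omega n)⁻¹ * (meridian n * (meridian' n)⁻¹)⁻¹ := by
    rw [omega]; group
  have hr : (meridian' n)⁻¹ * (omega n ^ n)⁻¹ = (omega n ^ n)⁻¹ * (meridian n)⁻¹ := by
    rw [← _root_.mul_inv_rev, ← _root_.mul_inv_rev, relation]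
  rw [longitude_eq_mul, h, conj_zpow, _root_.inv_zpow, _root_.mul_inv_rev, inv_inv]
  calc _ = omega n ^ n * meridian n * ((meridian' n)⁻¹ * (omega n ^ n)⁻¹) *
        (meridian' n * (meridian n)⁻¹) := by simp only [mul_assoc]
    _ = _ := by rw [hr]; simp only [mul_assoc]

theorem omega_mem_commutator (n : ℤ) : omega n ∈ commutator (KnotGroup n) := by
  rw [← Abelianization.ker_of, MonoidHom.mem_ker, omega]
  simp only [map_mul, map_inv]
  rw [mul_right_comm (Abelianization.of (meridian' n))]
  simp

/-! ### Reducibility criteria -/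

variable {ρ : KnotGroup n →* SL(2, ℂ)}

theorem not_isIrreducible_of_range {N A' B' : Matrix (Fin 2) (Fin 2) ℂ} (hN : N ≠ 0)
    (hdet : det N = 0) (hA : (ρ (meridian n)).1 * N = N * A')
    (hB : (ρ (meridian' n)).1 * N = N * B') : ¬ IsIrreducible ρ := by
  intro h
  have key : ∀ g : KnotGroup n, ∀ v ∈ LinearMap.range N.mulVecLin,
      (ρ g).1.mulVec v ∈ LinearMap.range N.mulVecLin := by
    intro g
    have hg : g ∈ Subgroup.closure (Set.range (PresentedGroup.of (rels := {relator n}))) := by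
      rw [PresentedGroup.closure_range_of]; trivial
    induction hg using Subgroup.closure_induction with
    | mem x hx =>
      obtain ⟨i, rfl⟩ := hx
      rintro _ ⟨v, rfl⟩
      fin_cases i
      · refine ⟨A'.mulVec v, ?_⟩
        simp only [mulVecLin_apply, mulVec_mulVec]
        exact congrArg (fun M => M.mulVec v) hA.symm
      · refine ⟨B'.mulVec v, ?_⟩
        simp only [mulVecLin_apply, mulVec_mulVec]
        exact congrArg (fun M => M.mulVec v) hB.symm
    | one => simp
    | mul x y _ _ hx hy =>
      intro v hv
      rw [map_mul, Matrix.SpecialLinearGroup.coe_mul, ← mulVec_mulVec]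
      exact hx _ (hy _ hv)
    | inv x _ hx =>
      intro v hv
      rw [map_inv, SL2.coe_inv_eq, sub_mulVec, smul_mulVec, one_mulVec]
      exact Submodule.sub_mem _ (Submodule.smul_mem _ _ hv) (hx _ hv)
  rcases h _ key with h | h
  · rw [LinearMap.range_eq_bot] at h
    apply hN
    rw [← toLin'_apply', LinearEquiv.map_eq_zero_iff] at h
    exact h
  · rw [LinearMap.range_eq_top] at h
    have hu : IsUnit N := mulVec_surjective_iff_isUnit.mp h
    rw [isUnit_iff_isUnit_det, hdet] at hu
    exact not_isUnit_zero hu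

theorem not_isIrreducible_of_nilpotent {N : Matrix (Fin 2) (Fin 2) ℂ} (hN : N ≠ 0)
    (htr : trace N = 0) (hdet : det N = 0) (hA : trace (N * (ρ (meridian n)).1) = 0)
    (hB : trace (N * (ρ (meridian' n)).1) = 0) : ¬ IsIrreducible ρ := by
  refine not_isIrreducible_of_range hN hdet
    (A' := trace (ρ (meridian n)).1 • 1 - (ρ (meridian n)).1)
    (B' := trace (ρ (meridian' n)).1 • 1 - (ρ (meridian' n)).1) ?_ ?_
  · rw [mul_add_mul_of_trace_eq_zero htr, hA]; simp
  · rw [mul_add_mul_of_trace_eq_zero htr, hB]; simp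

theorem not_isIrreducible_of_eq (h : ρ (meridian n) = ρ (meridian' n)) :
    ¬ IsIrreducible ρ := by
  obtain ⟨c, hc⟩ := IsAlgClosed.exists_eval₂_eq_zero (RingHom.id ℂ)
    (ρ (meridian n)).1.charpoly (by
      rw [charpoly_degree_eq_dim]; simp)
  by_cases h0 : (ρ (meridian n)).1 - c • 1 = 0
  · have hs : (ρ (meridian n)).1 = c • 1 := sub_eq_zero.mp h0
    refine not_isIrreducible_of_range (N := !![1, 0; 0, 0]) (A' := c • 1) (B' := c • 1)
      (fun h => ?_) (by simp [det_fin_two]) ?_ ?_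
    · simpa using congrFun (congrFun h 0) 0
    · rw [hs]; simp
    · rw [← h, hs]; simp
  · refine not_isIrreducible_of_range h0 (A' := (ρ (meridian n)).1)
      (B' := (ρ (meridian n)).1) ?_ ?_ ?_
    · have h1 : det (scalar (Fin 2) c - (ρ (meridian n)).1) = 0 := by
        rw [← eval_charpoly]; exact hc
      rw [det_fin_two] at h1 ⊢
      simp at h1 ⊢
      linear_combination h1
    · simp [mul_sub, sub_mul]
    · rw [← h]; simp [mul_sub, sub_mul]

theorem not_isIrreducible_of_omega_eq_one (h : ρ (omega n) = 1) : ¬ IsIrreducible ρ := by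
  apply not_isIrreducible_of_eq
  have := congrArg ρ (relation n)
  simpa [h] using this

theorem trace_meridian' : trace (ρ (meridian' n)).1 = trace (ρ (meridian n)).1 := by
  have := SL2.trace_conj (ρ (meridian n)) (ρ (omega n ^ n))⁻¹
  rw [inv_inv] at this
  rw [← this, meridian'_eq, map_mul, map_mul, map_inv]

theorem coe_map_omega : (ρ (omega n)).1 = (ρ (meridian' n)).1 * ((ρ (meridian n))⁻¹).1 *
    ((ρ (meridian' n))⁻¹).1 * (ρ (meridian n)).1 := by
  simp [omega]

theorem not_isIrreducible_of_trace_omega_eq_two (h : trace (ρ (omega n)).1 = 2) :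
    ¬ IsIrreducible ρ := by
  by_cases h1 : (ρ (omega n)).1 - 1 = 0
  · exact not_isIrreducible_of_omega_eq_one (Subtype.ext (sub_eq_zero.mp h1))
  have hd := SL2.det_eq (ρ (omega n))
  have ht := h
  rw [trace_fin_two] at ht
  refine not_isIrreducible_of_nilpotent h1 ?_ ?_ ?_ ?_
  · simp [h]
  · rw [det_fin_two]; simp; linear_combination hd - ht
  · rw [sub_mul, one_mul, trace_sub]
    set A := ρ (meridian n)
    set B := ρ (meridian' n)
    have e : (ρ (omega n)).1 * A.1 = trace A.1 • (ρ (omega n)).1 - (B * A⁻¹ * B⁻¹).1 := by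
      rw [coe_map_omega, mul_assoc _ A.1, SL2.mul_self, mul_sub, mul_smul_comm, mul_one]
      simp only [Matrix.SpecialLinearGroup.coe_mul]
      rfl
    rw [e, trace_sub, trace_smul, h, SL2.trace_conj, SL2.trace_inv, smul_eq_mul]; ring
  · rw [sub_mul, one_mul, trace_sub]
    set A := ρ (meridian n)
    set B := ρ (meridian' n)
    have e : B.1 * (ρ (omega n)).1 = trace B.1 • (ρ (omega n)).1 - (A⁻¹ * B⁻¹ * A⁻¹⁻¹).1 := by
      rw [coe_map_omega, ← mul_assoc, ← mul_assoc, ← mul_assoc, SL2.mul_self]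
      simp only [sub_mul, smul_mul_assoc, one_mul, Matrix.SpecialLinearGroup.coe_mul, inv_inv]
      rfl
    rw [trace_mul_comm, e, trace_sub, trace_smul, h, SL2.trace_conj, SL2.trace_inv,
      smul_eq_mul]; ring

/-! ### Representations of the surgered manifold -/

theorem trace_eq_zero_of_surgeryRelator (hirr : IsIrreducible ρ)
    (hs : ρ (surgeryRelator n) = 1) : trace (ρ (meridian n)).1 = 0 := by
  rw [surgeryRelator, longitude_eq] at hs
  have hB := trace_meridian' (ρ := ρ)
  have hW := not_isIrreducible_of_trace_omega_eq_two (ρ := ρ)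
  rw [omega] at hW
  simp only [map_mul, map_inv, map_pow] at hs hW
  set A := ρ (meridian n)
  set B := ρ (meridian' n)
  set P := ρ (omega n ^ n)
  have e : P * A * P⁻¹ = A⁻¹ * (A⁻¹ * A⁻¹ * B⁻¹) * A⁻¹⁻¹ := by
    have : P * A * P⁻¹ = (A ^ 4)⁻¹ * (A ^ 4 * (P * A * P⁻¹ * A⁻¹ * B * A⁻¹)) * (A * B⁻¹ * A) := by
      group
    rw [this, hs]; group
  have ht := SL2.trace_conj A P
  rw [e, SL2.trace_conj, ← _root_.mul_inv_rev, ← _root_.mul_inv_rev, SL2.trace_inv] at ht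
  simp only [Matrix.SpecialLinearGroup.coe_mul] at ht
  rw [trace_mul_comm, SL2.mul_self, sub_mul, trace_sub, smul_mul_assoc, trace_smul, one_mul, hB,
    smul_eq_mul] at ht
  have ht' : trace A.1 * (trace (A.1 * B.1) - 2) = 0 := by linear_combination ht
  rcases mul_eq_zero.mp ht' with h | h
  · exact h
  · refine absurd hirr (hW ?_)
    rw [SL2.trace_commutator, hB]
    linear_combination (trace (A.1 * B.1) + 2 - trace A.1 ^ 2) * h

theorem SL2.inv_eq_neg {A : SL(2, ℂ)} (h : trace A.1 = 0) : A⁻¹ = -A := by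
  apply Subtype.ext
  rw [SL2.coe_inv_eq, h]; simp

theorem SL2.mul_self_eq_neg_one {A : SL(2, ℂ)} (h : trace A.1 = 0) : A * A = -1 := by
  have := mul_inv_cancel A
  rw [SL2.inv_eq_neg h, mul_neg] at this
  rw [← this, neg_neg]

theorem isMetabelian_of_trace_eq_zero (h : trace (ρ (meridian n)).1 = 0) : IsMetabelian ρ := by
  have hA := SL2.inv_eq_neg h
  have hB := SL2.inv_eq_neg (trace_meridian'.trans h)
  have hAA := SL2.mul_self_eq_neg_one h
  have hBB := SL2.mul_self_eq_neg_one (trace_meridian'.trans h)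
  set δ := meridian n * (meridian' n)⁻¹ with hδ
  have hconj : ∀ g, ρ g * ρ δ * (ρ g)⁻¹ = ρ δ ∨ ρ g * ρ δ * (ρ g)⁻¹ = (ρ δ)⁻¹ := by
    intro g
    have hg : g ∈ Subgroup.closure (Set.range (PresentedGroup.of (rels := {relator n}))) := by
      rw [PresentedGroup.closure_range_of]; trivial
    induction hg using Subgroup.closure_induction with
    | mem x hx =>
      obtain ⟨i, rfl⟩ := hx
      right
      fin_cases i
      · change ρ (meridian n) * ρ δ * (ρ (meridian n))⁻¹ = _
        rw [hδ, map_mul, map_inv, _root_.mul_inv_rev, inv_inv, hA, hB]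
        simp only [mul_neg, neg_mul, neg_neg, ← mul_assoc, hAA]
        simp
      · change ρ (meridian' n) * ρ δ * (ρ (meridian' n))⁻¹ = _
        rw [hδ, map_mul, map_inv, _root_.mul_inv_rev, inv_inv, hA, hB]
        simp only [mul_neg, neg_mul, neg_neg, mul_assoc, hBB]
        simp
    | one => simp
    | mul x y _ _ hx hy =>
      have e : ρ (x * y) * ρ δ * (ρ (x * y))⁻¹ = ρ x * (ρ y * ρ δ * (ρ y)⁻¹) * (ρ x)⁻¹ := by
        rw [map_mul]; group
      have e' : ρ x * (ρ δ)⁻¹ * (ρ x)⁻¹ = (ρ x * ρ δ * (ρ x)⁻¹)⁻¹ := by group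
      rw [e]
      rcases hy with hy | hy <;> rw [hy]
      · exact hx
      · rw [e']
        rcases hx with hx | hx <;> rw [hx] <;> simp
    | inv x _ hx =>
      rw [map_inv, inv_inv]
      rcases hx with hx | hx
      · left; nth_rw 1 [← hx]; group
      · right
        have e : ρ δ = ρ x * (ρ δ)⁻¹ * (ρ x)⁻¹ :=
          calc ρ δ = (ρ δ)⁻¹⁻¹ := (inv_inv _).symm
            _ = (ρ x * ρ δ * (ρ x)⁻¹)⁻¹ := by rw [hx]
            _ = _ := by group
        calc (ρ x)⁻¹ * ρ δ * ρ x = (ρ x)⁻¹ * (ρ x * (ρ δ)⁻¹ * (ρ x)⁻¹) * ρ x := by rw [← e]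
          _ = _ := by group
  let K : Subgroup (KnotGroup n) := (Subgroup.zpowers (ρ δ)).comap ρ
  have hK : K.Normal := by
    refine ⟨fun x hx g => ?_⟩
    obtain ⟨k, hk⟩ := Subgroup.mem_zpowers_iff.mp (Subgroup.mem_comap.mp hx)
    have e : ρ (g * x * g⁻¹) = (ρ g * ρ δ * (ρ g)⁻¹) ^ k := by
      rw [conj_zpow, hk, map_mul, map_mul, map_inv]
    change ρ (g * x * g⁻¹) ∈ Subgroup.zpowers (ρ δ)
    rw [e]
    refine Subgroup.zpow_mem _ ?_ k
    rcases hconj g with h | h <;> rw [h]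
    · exact Subgroup.mem_zpowers _
    · exact Subgroup.inv_mem _ (Subgroup.mem_zpowers _)
  have hgen : ∀ g, (QuotientGroup.mk' K) g ∈
      Subgroup.zpowers (QuotientGroup.mk' K (meridian' n)) := by
    intro g
    refine mem_of_meridians_mem (H := (Subgroup.zpowers (QuotientGroup.mk' K (meridian' n))).comap
      (QuotientGroup.mk' K)) ?_ ?_ g
    · have : QuotientGroup.mk' K (meridian n) = QuotientGroup.mk' K (meridian' n) := by
        rw [← mul_inv_eq_one, ← map_inv, ← map_mul, QuotientGroup.mk'_apply,
          QuotientGroup.eq_one_iff]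
        exact Subgroup.mem_zpowers (ρ δ)
      rw [Subgroup.mem_comap, this]
      exact Subgroup.mem_zpowers _
    · exact Subgroup.mem_zpowers _
  have hcomm : commutator (KnotGroup n) ≤ K := by
    rw [commutator_def, Subgroup.commutator_le]
    intro x _ y _
    rw [← QuotientGroup.eq_one_iff, ← QuotientGroup.mk'_apply, map_commutatorElement,
      commutatorElement_eq_one_iff_mul_comm]
    obtain ⟨i, hi⟩ := Subgroup.mem_zpowers_iff.mp (hgen x)
    obtain ⟨j, hj⟩ := Subgroup.mem_zpowers_iff.mp (hgen y)
    rw [← hi, ← hj]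
    exact (Commute.refl _).zpow_zpow i j
  intro x hx y hy
  obtain ⟨i, hi⟩ := Subgroup.mem_zpowers_iff.mp (Subgroup.mem_comap.mp (hcomm hx))
  obtain ⟨j, hj⟩ := Subgroup.mem_zpowers_iff.mp (Subgroup.mem_comap.mp (hcomm hy))
  rw [← hi, ← hj]
  exact (Commute.refl _).zpow_zpow i j

theorem map_surgeryRelator_of_trace_eq_zero (h : trace (ρ (meridian n)).1 = 0) :
    ρ (surgeryRelator n) = 1 := by
  have hA := SL2.inv_eq_neg h
  have hB := SL2.inv_eq_neg (trace_meridian'.trans h)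
  rw [surgeryRelator, longitude_eq_mul, omega]
  simp only [map_mul, map_inv, map_pow, map_zpow]
  set A := ρ (meridian n)
  set B := ρ (meridian' n)
  have hA4 : A ^ 4 = 1 := by
    calc A ^ 4 = (A * A) * (A * A) := by simp [pow_succ, mul_assoc]
      _ = 1 := by rw [SL2.mul_self_eq_neg_one h]; simp
  have e : A * B⁻¹ * A⁻¹ * B = (B * A⁻¹ * B⁻¹ * A)⁻¹ := by
    simp only [_root_.mul_inv_rev, inv_inv]
    rw [hA, hB]
    simp [mul_assoc]
  rw [e, hA4, _root_.inv_zpow, mul_inv_cancel, one_mul]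

theorem trace_mul_eq_zero_of_commute {N A A' : Matrix (Fin 2) (Fin 2) ℂ} (hN : N * N = 0)
    (htr : trace N = 0) (hA' : A' = trace A • 1 - A)
    (hc : N * (A * N * A') = A * N * A' * N) : trace (N * A) = 0 := by
  have e := mul_add_mul_of_trace_eq_zero htr A
  rw [← hA'] at e
  set c := trace (N * A)
  have e1 : N * A * N = c • N := by
    rw [mul_assoc, e, mul_add, ← mul_assoc, hN]; simp
  have e2 : N * A' * N = -(c • N) := by
    rw [hA', mul_sub, mul_smul_comm, mul_one, sub_mul, smul_mul_assoc, hN, e1]; simp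
  have e3 : c • (N * A' + A * N) = 0 := by
    have l : N * (A * N * A') = c • (N * A') := by
      rw [← mul_assoc, ← mul_assoc, e1, smul_mul_assoc]
    have r : A * N * A' * N = -(c • (A * N)) := by
      rw [mul_assoc A, mul_assoc A, e2, mul_neg, mul_smul_comm]
    rw [smul_add, ← l, hc, r]; simp
  by_contra hne
  have e4 : N * A' + A * N = 0 := (smul_eq_zero.mp e3).resolve_left hne
  have e5 : c • N = 0 := by
    have := congrArg (N * ·) e4
    simp only [mul_add, ← mul_assoc, hN, zero_mul, zero_add, mul_zero, e1] at this
    exact this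
  have e6 : N = 0 := (smul_eq_zero.mp e5).resolve_left hne
  exact hne (by simp [c, e6])

theorem add_one_commute_conj {W A A' : Matrix (Fin 2) (Fin 2) ℂ}
    (h : W * (A * W * A') = A * W * A' * W) (hA : A * A' = 1) :
    (W + 1) * (A * (W + 1) * A') = A * (W + 1) * A' * (W + 1) := by
  simp only [mul_add, add_mul, mul_one, one_mul, hA, h]; abel

theorem trace_eq_zero_of_conj_eq {A W V : Matrix (Fin 2) (Fin 2) ℂ} {z : ℂ}
    (hz : z ^ 2 ≠ 4) (hW : W * W = z • W - 1) (h : A * W = V * A) (hV : V = z • 1 - W) :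
    trace A = 0 := by
  subst hV
  have h1 : 2 * trace (A * W) = z * trace A := by
    have := congrArg trace h
    rw [sub_mul, trace_sub, smul_mul_assoc, one_mul, trace_smul, trace_mul_comm W,
      smul_eq_mul] at this
    linear_combination this
  have h2 : 2 * trace (A * (W * W)) = z * trace (A * W) := by
    have := congrArg (fun M => trace (M * W)) h
    simp only [sub_mul, trace_sub, smul_mul_assoc, one_mul, trace_smul, smul_eq_mul] at this
    rw [mul_assoc W, trace_mul_comm W, mul_assoc] at this
    linear_combination this
  rw [hW, mul_sub, mul_smul_comm, trace_sub, trace_smul, mul_one, smul_eq_mul] at h2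
  have h3 : (z ^ 2 - 4) * trace A = 0 := by linear_combination 2 * h2 - z * h1
  exact (mul_eq_zero.mp h3).resolve_left (sub_ne_zero.mpr hz)

theorem eq_or_eq_of_commute {V W : Matrix (Fin 2) (Fin 2) ℂ} {z : ℂ} (hz : z ^ 2 ≠ 4)
    (hV : V * V = z • V - 1) (hW : W * W = z • W - 1) (htV : trace V = z) (htW : trace W = z)
    (hc : V * W = W * V) : V = W ∨ V = z • 1 - W := by
  have hEF : (V - W) * (V - (z • 1 - W)) = 0 := by
    simp only [sub_mul, mul_sub, mul_smul_comm, mul_one, hV, hW, hc]; module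
  have hFE : (V - (z • 1 - W)) * (V - W) = 0 := by
    simp only [sub_mul, mul_sub, smul_mul_assoc, one_mul, hV, hW, hc]; module
  have hE := mul_self_of_trace_eq_zero (N := V - W) (by rw [trace_sub, htV, htW, sub_self])
  have hF := mul_self_of_trace_eq_zero (N := V - (z • 1 - W))
    (by simp [trace_sub, htV, htW]; ring)
  have hS : ((V - W) - (V - (z • 1 - W))) * ((V - W) - (V - (z • 1 - W)))
      = (z ^ 2 - 4) • 1 := by
    have : (V - W) - (V - (z • 1 - W)) = z • 1 - (2 : ℂ) • W := by rw [two_smul]; abel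
    rw [this]
    simp only [sub_mul, mul_sub, smul_mul_assoc, mul_smul_comm, one_mul, mul_one, hW]
    module
  rw [← sub_eq_zero (a := V) (b := W), ← sub_eq_zero (a := V) (b := z • 1 - W)]
  set E := V - W
  set F := V - (z • 1 - W)
  by_contra! hne
  have e0 : -det E = 0 := by
    have : (-det E) • F = 0 := by
      rw [← one_mul F, ← smul_mul_assoc, ← hE, mul_assoc, hEF, mul_zero]
    exact (smul_eq_zero.mp this).resolve_right hne.2
  have f0 : -det F = 0 := by
    have : (-det F) • E = 0 := by
      rw [← one_mul E, ← smul_mul_assoc, ← hF, mul_assoc, hFE, mul_zero]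
    exact (smul_eq_zero.mp this).resolve_right hne.1
  have hexp : (E - F) * (E - F) = E * E - E * F - F * E + F * F := by
    clear_value E F; noncomm_ring
  rw [hexp, hEF, hFE, hE, hF, e0, f0] at hS
  simp only [zero_smul, sub_zero, add_zero] at hS
  have := (smul_eq_zero.mp hS.symm).resolve_right one_ne_zero
  exact hz (sub_eq_zero.mp this)

theorem trace_eq_zero_of_isMetabelian (hirr : IsIrreducible ρ) (hmet : IsMetabelian ρ) :
    trace (ρ (meridian n)).1 = 0 := by
  set W := ρ (omega n) with hWdef
  have hconj : ∀ g, W * (ρ g * W * (ρ g)⁻¹) = ρ g * W * (ρ g)⁻¹ * W := by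
    intro g
    simpa using hmet _ (omega_mem_commutator n) _
      ((inferInstance : (commutator (KnotGroup n)).Normal).conj_mem _
        (omega_mem_commutator n) g)
  have hWW := SL2.mul_self W
  by_cases hz : trace W.1 ^ 2 = 4
  · have hz' : (trace W.1 - 2) * (trace W.1 + 2) = 0 := by linear_combination hz
    rcases mul_eq_zero.mp hz' with h | h
    · exact absurd hirr (not_isIrreducible_of_trace_omega_eq_two (sub_eq_zero.mp h))
    have hz2 : trace W.1 = -2 := by linear_combination h
    by_cases hN : W.1 + 1 = 0
    · have hW1 : W = -1 := Subtype.ext (by simpa using eq_neg_of_add_eq_zero_left hN)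
      rw [hWdef, omega] at hW1
      simp only [map_mul, map_inv] at hW1
      have ht := SL2.trace_conj (ρ (meridian n))⁻¹ (ρ (meridian' n))
      rw [eq_mul_inv_of_mul_eq hW1] at ht
      simp only [neg_mul, one_mul, Matrix.SpecialLinearGroup.coe_neg, trace_neg, SL2.trace_inv] at ht
      linear_combination (-1 / 2 : ℂ) * ht
    · refine absurd hirr (not_isIrreducible_of_nilpotent hN ?_ ?_ ?_ ?_)
      all_goals have htN : trace (W.1 + 1) = 0 := by simp [hz2]
      · exact htN
      · have hd := SL2.det_eq W
        rw [trace_fin_two] at hz2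
        rw [det_fin_two]; simp; linear_combination hd + hz2
      all_goals
        have hNN : (W.1 + 1) * (W.1 + 1) = 0 := by
          rw [mul_add, add_mul, hWW, hz2, mul_one, one_mul]; module
        refine trace_mul_eq_zero_of_commute hNN htN (SL2.coe_inv_eq _) ?_
      · exact add_one_commute_conj (congrArg Subtype.val (hconj (meridian n)))
          (congrArg Subtype.val (mul_inv_cancel (ρ (meridian n))))
      · exact add_one_commute_conj (congrArg Subtype.val (hconj (meridian' n)))
          (congrArg Subtype.val (mul_inv_cancel (ρ (meridian' n))))
  · have hVW := (congrArg Subtype.val (hconj (meridian n))).symm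
    set A := ρ (meridian n) with hA
    have htV := SL2.trace_conj W A
    have hVV := SL2.mul_self (A * W * A⁻¹)
    rw [htV] at hVV
    rcases eq_or_eq_of_commute hz hVV hWW htV rfl hVW with h | h
    · refine absurd hirr (not_isIrreducible_of_eq ?_)
      have hcomm : Commute A W := mul_inv_eq_iff_eq_mul.mp (Subtype.ext h)
      have := congrArg ρ (meridian'_eq n)
      simp only [map_mul, map_inv, map_zpow, ← hWdef, ← hA] at this
      rw [this, mul_assoc, (hcomm.zpow_right n).eq, inv_mul_cancel_left]
    · exact trace_eq_zero_of_conj_eq hz hWW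
        (congrArg Subtype.val (inv_mul_cancel_right (A * W) A).symm) h

/-! ### Pull-back along the quotient map -/

theorem quotientMap_surjective (n : ℤ) : Function.Surjective (quotientMap n) :=
  QuotientGroup.mk'_surjective _

theorem isIrreducible_comp_quotientMap {ρbar : SurgeryGroup n →* SL(2, ℂ)} :
    IsIrreducible (ρbar.comp (quotientMap n)) ↔ IsIrreducible ρbar := by
  refine forall_congr' fun W => imp_congr_left ?_
  exact ((quotientMap_surjective n).forall
    (p := fun g => ∀ v ∈ W, (ρbar g : Matrix (Fin 2) (Fin 2) ℂ).mulVec v ∈ W)).symm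

theorem quotientMap_surgeryRelator (n : ℤ) : quotientMap n (surgeryRelator n) = 1 :=
  (QuotientGroup.eq_one_iff _).mpr (Subgroup.subset_normalClosure rfl)

theorem isMetabelian_comp_quotientMap {ρbar : SurgeryGroup n →* SL(2, ℂ)}
    (h : IsIrreducible ρbar) : IsMetabelian (ρbar.comp (quotientMap n)) :=
  isMetabelian_of_trace_eq_zero <| trace_eq_zero_of_surgeryRelator
    (isIrreducible_comp_quotientMap.mpr h) <| by
      rw [MonoidHom.comp_apply, quotientMap_surgeryRelator, map_one]

end TwistKnot

theorem proposition3p1 (n : ℤ) (hn₀ : n ≠ 0) (hn₁ : n ≠ -1) :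
    (∀ ρbar : TwistKnot.SurgeryGroup n →* SL(2, ℂ), TwistKnot.IsIrreducible ρbar →
      ∃ ρ : TwistKnot.KnotGroup n →* SL(2, ℂ),
        TwistKnot.IsIrreducible ρ ∧ TwistKnot.IsMetabelian ρ ∧
          ρbar.comp (TwistKnot.quotientMap n) = ρ) ∧
    (fun ρbar : TwistKnot.SurgeryGroup n →* SL(2, ℂ) => ρbar.comp (TwistKnot.quotientMap n)) ''
        {ρbar | TwistKnot.IsIrreducible ρbar} =
      {ρ : TwistKnot.KnotGroup n →* SL(2, ℂ) |
        TwistKnot.IsIrreducible ρ ∧ TwistKnot.IsMetabelian ρ} := by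
  refine ⟨fun ρbar h => ⟨_, TwistKnot.isIrreducible_comp_quotientMap.mpr h,
    TwistKnot.isMetabelian_comp_quotientMap h, rfl⟩, Set.Subset.antisymm ?_ ?_⟩
  · rintro _ ⟨ρbar, h, rfl⟩
    exact ⟨TwistKnot.isIrreducible_comp_quotientMap.mpr h,
      TwistKnot.isMetabelian_comp_quotientMap h⟩
  · rintro ρ ⟨hirr, hmet⟩
    have hs := TwistKnot.map_surgeryRelator_of_trace_eq_zero
      (TwistKnot.trace_eq_zero_of_isMetabelian hirr hmet)
    have hle : Subgroup.normalClosure {TwistKnot.surgeryRelator n} ≤ ρ.ker :=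
      Subgroup.normalClosure_le_normal (by simpa [MonoidHom.mem_ker] using hs)
    have e : (QuotientGroup.lift _ ρ hle).comp (TwistKnot.quotientMap n) = ρ :=
      MonoidHom.ext fun _ => rfl
    exact ⟨QuotientGroup.lift _ ρ hle, TwistKnot.isIrreducible_comp_quotientMap.mp
      (by rw [e]; exact hirr), e⟩
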